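/- Let $G=(V,E)$ be a finite, simple, connected graph. Fix any orientation of its edges and let $A_G\in\mathbb{R}^{V\times E}$ be the incidence matrix, whose column for an edge oriented from $j$ to $k$ is $e_k-e_j$. A network matrix of $G$ is a matrix $[\,W\mid I\,]$ with $|V|-1$ rows, and with columns indexed by $E$ (in some order), such that elementary row operations turn $A_G$ into $[\,W\mid I\,]$ together with one row of zeros. Put $A_G^{\triangle}:=[\,I\mid -W^{T}\,]$, a matrix with $|E|-|V|+1$ rows and with the same indexing of its columns by $E$. The tocyclotope of $G$ is the zonotope $Z(A_G^{\triangle}):=A_G^{\triangle}[0,1]^{E}$. A set of edges of $G$ is spanning if it contains the edges of a spanning tree of $G$. For $k\ge 0$ let $d_k$ be the number of sets $F\subseteq E$ with $|F|=k$ such that $E\setminus F$ is spanning. Then network matrices of $G$ exist and, for every choice of the orientation and of the network matrix, the Ehrhart polynomial of the tocyclotope is $$\operatorname{ehr}_{Z(A_G^{\triangle})}(t)=\sum_{k=0}^{|E|-|V|+1} d_k\,t^k ,$$ that is, for every positive integer $t$ the dilate $t\,Z(A_G^{\triangle})$ contains exactly $\sum_{k=0}^{|E|-|V|+1} d_k\,t^k$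 integer points. Moreover, for every $k$, $d_k$ equals the number of $k$-element independent sets of the cographic matroid of $G$, that is, of sets of $k$ edges whose columns in $A_G^{\triangle}$ are linearly independent. Finally, if a multigraph $G^{\triangle}$ with the same edge set $E$ is a dual graph of $G$ (the edge sets of cycles of $G$ are exactly the bonds, i.e. the minimal nonempty cuts, of $G^{\triangle}$), then, for every $k$, $d_k$ equals the number of forests with $k$ edges in $G^{\triangle}$. -/

import Mathlib

/-! ### Zonotopes and Ehrhart polynomials -/

/-- The zonotope `A [0,1]^m` generated by the columns of a real matrix `A`. -/
def zonotope {m n : Type*} [Fintype m] (A : Matrix n m ℝ) : Set (n → ℝ) :=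
  (fun x : m → ℝ => A.mulVec x) '' Set.Icc 0 1

/-- The lattice `ℤⁿ` inside `ℝⁿ`. -/
def integerPoints (n : Type*) : Set (n → ℝ) :=
  Set.range fun (z : n → ℤ) (i : n) => (z i : ℝ)

open scoped Pointwise in
/-- `p` is the Ehrhart polynomial of `P ⊆ ℝⁿ`: for every positive integer `t`, the dilate `t P`
contains exactly `p(t)` (in particular, finitely many) lattice points. -/
def IsEhrhartPolynomial {n : Type*} (P : Set (n → ℝ)) (p : Polynomial ℝ) : Prop :=
  ∀ t : ℕ, 0 < t →
    (((t : ℝ) • P) ∩ integerPoints n).Finite ∧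
      ((((t : ℝ) • P) ∩ integerPoints n).ncard : ℝ) = p.eval (t : ℝ)

namespace SimpleGraph

/-! ### Incidence matrices, network matrices and their duals -/

/-- An orientation of the edges of `G`: every edge gets a tail and a head. -/
structure EdgeOrientation {V : Type*} (G : SimpleGraph V) where
  tail : G.edgeSet → V
  head : G.edgeSet → V
  mk_eq : ∀ e : G.edgeSet, s(tail e, head e) = (e : Sym2 V)

/-- The incidence matrix of an oriented graph: the column of the edge `j → k` is `e_k - e_j`. -/
def EdgeOrientation.incidenceMatrix {V : Type*} [DecidableEq V] {G : SimpleGraph V}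
    (o : G.EdgeOrientation) : Matrix V G.edgeSet ℝ :=
  fun v e => (Pi.single (o.head e) 1 - Pi.single (o.tail e) 1 : V → ℝ) v

/-- The matrix `[W | I]`; the columns of the identity block are indexed by the edges in `T`,
those of `W` by the edges not in `T`. -/
def blockMatrix {V : Type*} [DecidableEq V] {G : SimpleGraph V} (T : Finset G.edgeSet)
    (W : Matrix {e // e ∈ T} {e // e ∉ T} ℝ) : Matrix {e // e ∈ T} G.edgeSet ℝ :=
  (Matrix.fromCols (1 : Matrix {e // e ∈ T} {e // e ∈ T} ℝ) W).submatrix id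
    (Equiv.sumCompl (· ∈ T)).symm

/-- The matrix `[I | -Wᵀ]`; as in `[W | I]`, its columns are indexed by all edges, the columns of
the identity block now being those of the edges not in `T`. -/
def dualBlockMatrix {V : Type*} [DecidableEq V] {G : SimpleGraph V} (T : Finset G.edgeSet)
    (W : Matrix {e // e ∈ T} {e // e ∉ T} ℝ) : Matrix {e // e ∉ T} G.edgeSet ℝ :=
  (Matrix.fromCols (-W.transpose) (1 : Matrix {e // e ∉ T} {e // e ∉ T} ℝ)).submatrix id
    (Equiv.sumCompl (· ∈ T)).symm

/-- `[W | I]` is a network matrix of the oriented graph: elementary row operations (that is, left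
multiplication by an invertible matrix `U`) turn the incidence matrix into `[W | I]` with one
additional row of zeros. The bijection `r` names the rows of the result. -/
def EdgeOrientation.IsNetworkMatrix {V : Type*} [Fintype V] [DecidableEq V] {G : SimpleGraph V}
    (o : G.EdgeOrientation) (T : Finset G.edgeSet)
    (W : Matrix {e // e ∈ T} {e // e ∉ T} ℝ) : Prop :=
  ∃ (U : Matrix V V ℝ) (r : {e // e ∈ T} ⊕ Unit ≃ V), IsUnit U ∧
    (U * o.incidenceMatrix).submatrix r id =
      Matrix.fromRows (blockMatrix T W) (0 : Matrix Unit G.edgeSet ℝ)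

/-! ### Spanning sets -/

/-- A set of edges of `G` is spanning if it contains (the edge set of) a spanning tree. -/
def IsSpanningSet {V : Type*} (G : SimpleGraph V) (S : Set G.edgeSet) : Prop :=
  ∃ T : SimpleGraph V, T.IsTree ∧ T.edgeSet ⊆ Subtype.val '' S

/-- The number of `k`-element sets of edges that are complements of spanning sets of `G`. -/
noncomputable def numCospanning {V : Type*} (G : SimpleGraph V) (k : ℕ) : ℕ :=
  {F : Finset G.edgeSet | F.card = k ∧ G.IsSpanningSet (F : Set G.edgeSet)ᶜ}.ncard

/-- `C` is the set of edges of a cycle of the simple graph `G`. -/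
def IsCycleEdgeSet {V : Type*} (G : SimpleGraph V) (C : Set G.edgeSet) : Prop :=
  ∃ (v : V) (p : G.Walk v v), p.IsCycle ∧ C = {e | (e : Sym2 V) ∈ p.edges}

end SimpleGraph

/-! ### Multigraphs and abstract duals -/

namespace Graph

/-- `C` is the set of edges of a cycle of the multigraph `H`: there are `n ≥ 1` distinct vertices
`v 0, …, v (n - 1)` and distinct edges `e i` joining `v i` to `v (i + 1)`, indices modulo `n`.
A loop is a cycle with `n = 1`, a pair of parallel edges is one with `n = 2`. -/
def IsCycleEdgeSet {α β : Type*} (H : Graph α β) (C : Set β) : Prop :=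
  ∃ (n : ℕ) (_ : NeZero n) (v : Fin n → α) (e : Fin n → β),
    Function.Injective v ∧ Function.Injective e ∧ (∀ i, H.IsLink (e i) (v i) (v (i + 1))) ∧
      C = Set.range e

/-- `F` is the set of edges of a forest in `H`. -/
def IsForestEdgeSet {α β : Type*} (H : Graph α β) (F : Set β) : Prop :=
  F ⊆ H.edgeSet ∧ ∀ C ⊆ F, ¬ H.IsCycleEdgeSet C

/-- The cut of `H` given by a set `X` of vertices: all edges with one end in `X` and the other
end outside of `X`. -/
def cut {α β : Type*} (H : Graph α β) (X : Set α) : Set β :=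
  {e | ∃ x ∈ X, ∃ y ∉ X, H.IsLink e x y}

/-- A bond is a minimal nonempty cut. -/
def IsBond {α β : Type*} (H : Graph α β) (B : Set β) : Prop :=
  Minimal (fun B : Set β => B.Nonempty ∧ ∃ X : Set α, B = H.cut X) B

end Graph

/-- The multigraph `H`, with the same edges as `G`, is a dual graph of `G`: the sets of edges
of cycles of `G` are exactly the bonds of `H`. -/
def SimpleGraph.IsDualGraph {V α : Type*} (G : SimpleGraph V) (H : Graph α G.edgeSet) : Prop :=
  H.edgeSet = Set.univ ∧ ∀ C : Set G.edgeSet, G.IsCycleEdgeSet C ↔ H.IsBond C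

/-! ### Lattice points generated by a regular family of vectors -/

/-! The kernel of `[I | -Wᵀ]` is the row space of `[W | I]`, which is the space of tensions
(potential differences) of `G`. Two facts about potentials then replace total unimodularity.
Rounding a potential down changes each tension by less than one, so every lattice point of the
dilated zonotope is the image of a lattice point of the cube `[0, t]^E`
(`smul_zonotope_inter_integerPoints`). An upper level set of a potential is a cut that conforms in
sign to its tension, so the columns form a regular family (`isRegularOn`).

For a regular family, the images of the lattice points of the cube are counted by deletion and
contraction (`IsRegularOn.ncard_latticeBox`). Without the vector `a e`, the image meets each coset
of `ℤ a e` in an interval; restoring `a e` with coefficients `0, …, t` lengthens each nonempty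
interval by `t` points. The cosets met are the image for the family modulo `a e`. The sum of `t ^
|F|` over independent `F` obeys the same recursion.

A dependence among the columns in `F` is a nonzero tension vanishing off `F`, so `F` is independent
exactly when its complement meets every nonempty cut, i.e. is spanning.

For a dual graph, two facts are played against each other: a cycle and a cut never share exactly one
edge, and each edge of a set `D` of edges can be certified either by a cycle inside `D` or by a cut
meeting `D` in that edge only (`Graph.exists_isCycleEdgeSet_or_cut`). -/

section RegularFamily

variable {E L : Type*} [AddCommGroup L]

/-- The combinations of the vectors `a e`, `e ∈ S`, with integer coefficients in `[0, t]`. -/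
def latticeBox (a : E → L) (S : Finset E) (t : ℕ) : Set L :=
  {l | ∃ x : E → ℤ, (∀ e ∈ S, 0 ≤ x e ∧ x e ≤ t) ∧ ∑ e ∈ S, x e • a e = l}

/-- Every nontrivial integer relation between the vectors `a e`, `e ∈ S`, conforms in sign to a
nontrivial relation with coefficients in `{0, 1, -1}`. -/
def IsRegularOn (a : E → L) (S : Finset E) : Prop :=
  ∀ x : E → ℤ, ∑ e ∈ S, x e • a e = 0 → (∃ e ∈ S, x e ≠ 0) →
    ∃ c : E → ℤ, (∃ e ∈ S, c e ≠ 0) ∧ (∀ e ∈ S, c e = 0 ∨ c e = (x e).sign) ∧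
      ∑ e ∈ S, c e • a e = 0

/-- The vectors `a e`, `e ∈ F`, satisfy no nontrivial integer relation. -/
def IsIntIndep (a : E → L) (F : Finset E) : Prop :=
  ∀ x : E → ℤ, ∑ e ∈ F, x e • a e = 0 → ∀ e ∈ F, x e = 0

/-! ### Deletion and contraction in regular families -/

lemma sum_insert_update_zsmul [DecidableEq E] (a : E → L) {S : Finset E} {e : E} (he : e ∉ S)
    (x : E → ℤ) (k : ℤ) :
    ∑ i ∈ insert e S, Function.update x e k i • a i = k • a e + ∑ i ∈ S, x i • a i := by
  rw [Finset.sum_insert he, Function.update_self]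
  congr 1
  refine Finset.sum_congr rfl fun i hi => ?_
  rw [Function.update_of_ne (ne_of_mem_of_not_mem hi he)]

lemma IsRegularOn.of_insert [DecidableEq E] {a : E → L} {S : Finset E} {e : E} (he : e ∉ S)
    (h : IsRegularOn a (insert e S)) : IsRegularOn a S := by
  intro x hx ⟨i, hi, hxi⟩
  have hne : ∀ j ∈ S, j ≠ e := fun j hj => ne_of_mem_of_not_mem hj he
  obtain ⟨c, ⟨j, hj, hcj⟩, hc, hsum⟩ := h (Function.update x e 0)
    (by rw [sum_insert_update_zsmul a he, hx]; simp)
    ⟨i, Finset.mem_insert_of_mem hi, by rwa [Function.update_of_ne (hne i hi)]⟩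
  have hce : c e = 0 := by simpa using hc e (Finset.mem_insert_self _ _)
  refine ⟨c, ⟨j, (Finset.mem_insert.1 hj).resolve_left ?_, hcj⟩, fun j hj => ?_, ?_⟩
  · rintro rfl
    exact hcj hce
  · simpa [Function.update_of_ne (hne j hj)] using hc j (Finset.mem_insert_of_mem hj)
  · simpa [Finset.sum_insert he, hce] using hsum

/-- A relation modulo `a e` lifts to a relation with an extra coefficient at `e`. The conformal
relation found upstairs projects back; it cannot be supported on `e` alone, since that would say `±a
e = 0`. -/
lemma IsRegularOn.quotient [DecidableEq E] {a : E → L} {S : Finset E} {e : E} (he : e ∉ S)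
    (h : IsRegularOn a (insert e S)) (hae : a e ≠ 0) :
    IsRegularOn (fun i => (a i : L ⧸ AddSubgroup.zmultiples (a e))) S := by
  intro x hx ⟨i, hi, hxi⟩
  have hne : ∀ j ∈ S, j ≠ e := fun j hj => ne_of_mem_of_not_mem hj he
  have hx' : ((∑ i ∈ S, x i • a i : L) : L ⧸ AddSubgroup.zmultiples (a e)) = 0 := by
    rw [← hx, ← QuotientAddGroup.mk'_apply, map_sum]
    rfl
  obtain ⟨k, hk⟩ := AddSubgroup.mem_zmultiples_iff.1 ((QuotientAddGroup.eq_zero_iff _).1 hx')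
  obtain ⟨c, ⟨j, hj, hcj⟩, hc, hsum⟩ := h (Function.update x e (-k))
    (by rw [sum_insert_update_zsmul a he, ← hk]; simp)
    ⟨i, Finset.mem_insert_of_mem hi, by rwa [Function.update_of_ne (hne i hi)]⟩
  refine ⟨c, ?_, fun j hj => ?_, ?_⟩
  · by_contra! hcS
    rw [Finset.sum_insert he, Finset.sum_eq_zero (fun i hi => by rw [hcS i hi, zero_smul]),
      add_zero] at hsum
    have hje : j = e := (Finset.mem_insert.1 hj).resolve_right fun hj => hcj (hcS j hj)
    subst hje
    have h1 := (hc j hj).resolve_left hcj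
    rcases Int.sign_trichotomy (Function.update x j (-k) j) with h2 | h2 | h2 <;>
      rw [h1, h2] at hsum hcj <;> simp_all
  · simpa [Function.update_of_ne (hne j hj)] using hc j (Finset.mem_insert_of_mem hj)
  · have := congrArg (QuotientAddGroup.mk' (AddSubgroup.zmultiples (a e))) hsum
    rw [Finset.sum_insert he, map_add, map_zero, map_zsmul, map_sum, QuotientAddGroup.mk'_apply,
      (QuotientAddGroup.eq_zero_iff _).2 (AddSubgroup.mem_zmultiples _), smul_zero,
      zero_add] at this
    exact this

lemma IsRegularOn.eq_zero_of_zsmul_eq_zero [DecidableEq E] {a : E → L} {S : Finset E}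
    (h : IsRegularOn a S) {e : E} (he : e ∈ S) (hae : a e ≠ 0) {k : ℤ} (hk : k • a e = 0) :
    k = 0 := by
  by_contra hk0
  have key : ∀ m : ℤ, ∑ i ∈ S, (Pi.single e m : E → ℤ) i • a i = m • a e := fun m => by
    rw [Finset.sum_eq_single_of_mem e he (fun i _ hi => by simp [hi])]
    simp
  obtain ⟨c, ⟨j, hj, hcj⟩, hc, hsum⟩ := h (Pi.single e k) ((key k).trans hk) ⟨e, he, by simpa⟩
  have hc0 : ∀ i ∈ S, i ≠ e → c i = 0 := fun i hi hie => by simpa [hie] using hc i hi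
  rw [Finset.sum_eq_single_of_mem e he (fun i hi hie => by rw [hc0 i hi hie, zero_smul])] at hsum
  obtain rfl : j = e := by
    by_contra hje
    exact hcj (hc0 j hj hje)
  have h1 := (hc j hj).resolve_left hcj
  rcases Int.sign_trichotomy ((Pi.single j k : E → ℤ) j) with h2 | h2 | h2 <;>
    rw [h1, h2] at hsum hcj <;> simp_all

/-- This is the interval property. If `x` and `y` represent `l` and `l + k • a e`, then `y - x`
together with `-k` at `e` is a relation, and adding a conformal `c` to `x` moves it towards `y`
without leaving the box. Either `c e = -1`, and `x + c` represents `l + a e`, or `c e = 0`, and `x +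
c` represents `l` again but is closer to `y` in the ℓ¹ distance. -/
lemma IsRegularOn.add_mem_latticeBox [DecidableEq E] {a : E → L} {S : Finset E} {e : E}
    (he : e ∉ S) (h : IsRegularOn a (insert e S)) {t : ℕ} {l : L} {k : ℤ} (hk : 0 < k)
    (hl : l ∈ latticeBox a S t) (hlk : l + k • a e ∈ latticeBox a S t) :
    l + a e ∈ latticeBox a S t := by
  obtain ⟨x, hx, hxl⟩ := hl
  obtain ⟨y, hy, hyl⟩ := hlk
  have hne : ∀ j ∈ S, j ≠ e := fun j hj => ne_of_mem_of_not_mem hj he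
  induction hn : ∑ i ∈ S, (y i - x i).natAbs using Nat.strong_induction_on generalizing x with
  | _ n ih =>
    obtain ⟨c, ⟨j, hj, hcj⟩, hc, hsum⟩ := h (Function.update (fun i => y i - x i) e (-k))
      (by
        rw [sum_insert_update_zsmul a he]
        simp only [sub_smul, Finset.sum_sub_distrib, hxl, hyl]
        simp)
      ⟨e, Finset.mem_insert_self _ _, by simpa using hk.ne'⟩
    have hcS : ∀ i ∈ S, c i = 0 ∨ c i = (y i - x i).sign := fun i hi => by
      simpa [Function.update_of_ne (hne i hi)] using hc i (Finset.mem_insert_of_mem hi)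
    have hce : c e = 0 ∨ c e = -1 := by
      simpa [Int.sign_eq_one_of_pos hk] using hc e (Finset.mem_insert_self _ _)
    have hstep : ∀ i ∈ S, (0 ≤ x i + c i ∧ x i + c i ≤ t) ∧
        (y i - (x i + c i)).natAbs ≤ (y i - x i).natAbs ∧
        (c i ≠ 0 → (y i - (x i + c i)).natAbs < (y i - x i).natAbs) := by
      intro i hi
      have h1 := hx i hi
      have h2 := hy i hi
      rcases hcS i hi with h3 | h3
      · simp [h3, h1]
      · rcases lt_trichotomy (y i - x i) 0 with h4 | h4 | h4
        · rw [Int.sign_eq_neg_one_of_neg h4] at h3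
          omega
        · rw [h4, Int.sign_zero] at h3
          omega
        · rw [Int.sign_eq_one_of_pos h4] at h3
          omega
    rw [Finset.sum_insert he] at hsum
    have hxc : ∑ i ∈ S, (x i + c i) • a i = l - c e • a e := by
      simp only [add_smul, Finset.sum_add_distrib, hxl]
      rw [eq_neg_of_add_eq_zero_right hsum, sub_eq_add_neg]
    rcases hce with hce | hce
    · have hjS : j ∈ S := (Finset.mem_insert.1 hj).resolve_left (by rintro rfl; exact hcj hce)
      refine ih _ ?_ (fun i => x i + c i) (fun i hi => (hstep i hi).1)
        (by rw [hxc, hce]; simp) rfl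
      rw [← hn]
      exact Finset.sum_lt_sum (fun i hi => (hstep i hi).2.1) ⟨j, hjS, (hstep j hjS).2.2 hcj⟩
    · exact ⟨fun i => x i + c i, fun i hi => (hstep i hi).1, by rw [hxc, hce]; simp⟩

/-! ### Counting points along the cosets of a vector -/

/-- If `A` is an interval on each line in the direction of `v`, then adding one step in this
direction adds one point for every such line that meets `A`. -/
lemma ncard_union_add_right {A : Set L} (hA : A.Finite) {v : L}
    (hv : ∀ k : ℤ, k • v = 0 → k = 0)
    (hconv : ∀ l ∈ A, ∀ k : ℤ, 0 < k → l + k • v ∈ A → l + v ∈ A) :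
    (A ∪ (· + v) '' A).ncard =
      A.ncard + ((fun l : L => (l : L ⧸ AddSubgroup.zmultiples v)) '' A).ncard := by
  -- Only the translates of exit points, those `l` with `l + v` outside `A`, are new.
  have h1 : A ∪ (· + v) '' A = A ∪ (· + v) '' {l ∈ A | l + v ∉ A} := by
    ext l
    simp only [Set.mem_union, Set.mem_image, Set.mem_ofPred_eq]
    constructor
    · rintro (h | ⟨m, hm, rfl⟩)
      · exact .inl h
      · by_cases h : m + v ∈ A
        · exact .inl h
        · exact .inr ⟨m, ⟨hm, h⟩, rfl⟩
    · rintro (h | ⟨m, hm, rfl⟩)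
      · exact .inl h
      · exact .inr ⟨m, hm.1, rfl⟩
  have hfin : {l ∈ A | l + v ∉ A}.Finite := hA.subset fun l hl => hl.1
  have h2 : (fun l : L => (l : L ⧸ AddSubgroup.zmultiples v)) '' A =
      (fun l : L => (l : L ⧸ AddSubgroup.zmultiples v)) '' {l ∈ A | l + v ∉ A} := by
    refine subset_antisymm ?_ (Set.image_mono fun l hl => hl.1)
    rintro _ ⟨l, hl, rfl⟩
    by_contra hcon
    -- A line meeting `A` without an exit point would contain a whole ray in `A`, against
    -- finiteness.
    have hall : ∀ n : ℕ, l + n • v ∈ A := by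
      intro n
      induction n with
      | zero => simpa using hl
      | succ n ih =>
        by_contra hn
        refine hcon ⟨l + n • v, ⟨ih, by rwa [add_assoc, ← succ_nsmul]⟩, ?_⟩
        refine QuotientAddGroup.eq.2 (AddSubgroup.mem_zmultiples_iff.2 ⟨-n, ?_⟩)
        simp
    refine Set.infinite_of_injective_forall_mem (f := fun n : ℕ => l + n • v) ?_ hall hA
    intro m n hmn
    have := hv (m - n) (by
      rw [sub_smul, natCast_zsmul, natCast_zsmul, sub_eq_zero]
      exact add_left_cancel hmn)
    omega
  rw [h1, h2, Set.ncard_union_eq ?_ hA (hfin.image _), Set.ncard_image_of_injective _ (add_left_injective v),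
    Set.InjOn.ncard_image]
  -- Two exit points on one line coincide: from the earlier one, convexity would allow a further
  -- step.
  · intro l hl m hm hlm
    obtain ⟨k, hk⟩ := AddSubgroup.mem_zmultiples_iff.1 (QuotientAddGroup.eq.1 hlm)
    rcases lt_trichotomy k 0 with h | rfl | h
    · refine absurd (hconv m hm.1 (-k) (by omega) ?_) hm.2
      rw [neg_smul, hk]
      simpa using hl.1
    · rw [zero_smul] at hk
      exact (neg_add_eq_zero.1 hk.symm)
    · refine absurd (hconv l hl.1 k h ?_) hl.2
      rw [hk]
      simpa using hm.1
  · rw [Set.disjoint_left]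
    rintro _ hl ⟨m, hm, rfl⟩
    exact hm.2 hl

/-- The union of the translates of `A` by `0, v, …, t v`. -/
def sweep (A : Set L) (v : L) (t : ℕ) : Set L :=
  {l | ∃ k : ℤ, 0 ≤ k ∧ k ≤ t ∧ ∃ m ∈ A, m + k • v = l}

/-- Replacing `A` by its union with `A + v` preserves the interval property and the set of lines
met, so each of the `t` steps adds the same number of points. -/
lemma ncard_sweep {A : Set L} (hA : A.Finite) {v : L} (hv : ∀ k : ℤ, k • v = 0 → k = 0)
    (hconv : ∀ l ∈ A, ∀ k : ℤ, 0 < k → l + k • v ∈ A → l + v ∈ A) (t : ℕ) :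
    (sweep A v t).Finite ∧ (sweep A v t).ncard =
      A.ncard + t * ((fun l : L => (l : L ⧸ AddSubgroup.zmultiples v)) '' A).ncard := by
  induction t generalizing A with
  | zero =>
    have : sweep A v 0 = A := by
      ext l
      constructor
      · rintro ⟨k, hk, hk', m, hm, rfl⟩
        obtain rfl : k = 0 := by push_cast at hk'; omega
        simpa using hm
      · exact fun h => ⟨0, le_rfl, by simp, l, h, by simp⟩
    simp [this, hA]
  | succ t ih =>
    have h1 : sweep A v (t + 1) = sweep (A ∪ (· + v) '' A) v t := by
      ext l
      constructor
      · rintro ⟨k, hk, hk', m, hm, rfl⟩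
        rcases hk.eq_or_lt with rfl | hk
        · exact ⟨0, le_rfl, by simp, m, .inl hm, rfl⟩
        · refine ⟨k - 1, by omega, by push_cast at hk'; omega, m + v, .inr ⟨m, hm, rfl⟩, ?_⟩
          rw [sub_smul, one_smul]
          abel
      · rintro ⟨k, hk, hk', m, hm | ⟨m, hm, rfl⟩, rfl⟩
        · exact ⟨k, hk, by push_cast; omega, m, hm, rfl⟩
        · refine ⟨k + 1, by omega, by push_cast; omega, m, hm, ?_⟩
          rw [add_smul, one_smul]
          dsimp only
          abel
    have h2 : (fun l : L => (l : L ⧸ AddSubgroup.zmultiples v)) '' (A ∪ (· + v) '' A) =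
        (fun l : L => (l : L ⧸ AddSubgroup.zmultiples v)) '' A := by
      rw [Set.image_union, Set.image_image]
      refine Set.union_eq_left.2 ?_
      rintro _ ⟨l, hl, rfl⟩
      exact ⟨l, hl, QuotientAddGroup.eq.2 (AddSubgroup.mem_zmultiples_iff.2 ⟨1, by simp⟩)⟩
    have h3 := ih (A := A ∪ (· + v) '' A) (hA.union (hA.image _)) (by
      intro l hl k hk hlk
      suffices l ∈ A from .inr ⟨l, this, rfl⟩
      rcases hl with hl | ⟨m, hm, rfl⟩
      · exact hl
      · rcases hlk with hlk | ⟨m', hm', hmm⟩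
        · refine hconv m hm (k + 1) (by omega) ?_
          convert hlk using 1
          rw [add_smul, one_smul]
          dsimp only
          abel
        · refine hconv m hm k hk ?_
          convert hm' using 1
          refine add_right_cancel (b := v) ?_
          dsimp only at hmm
          rw [hmm]
          abel)
    rw [h1, h3.2, h2, ncard_union_add_right hA hv hconv]
    exact ⟨h3.1, by ring⟩

lemma latticeBox_insert [DecidableEq E] (a : E → L) {S : Finset E} {e : E} (he : e ∉ S) (t : ℕ) :
    latticeBox a (insert e S) t = sweep (latticeBox a S t) (a e) t := by
  ext l
  constructor
  · rintro ⟨x, hx, rfl⟩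
    exact ⟨x e, (hx e (Finset.mem_insert_self _ _)).1, (hx e (Finset.mem_insert_self _ _)).2, _,
      ⟨x, fun i hi => hx i (Finset.mem_insert_of_mem hi), rfl⟩,
      by rw [Finset.sum_insert he, add_comm]⟩
  · rintro ⟨k, hk, hk', _, ⟨x, hx, rfl⟩, rfl⟩
    refine ⟨Function.update x e k, fun i hi => ?_, ?_⟩
    · rcases Finset.mem_insert.1 hi with rfl | hi
      · simp [hk, hk']
      · rw [Function.update_of_ne (ne_of_mem_of_not_mem hi he)]
        exact hx i hi
    · rw [sum_insert_update_zsmul a he, add_comm]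

lemma image_latticeBox (a : E → L) (S : Finset E) (t : ℕ) (v : L) :
    (fun l : L => (l : L ⧸ AddSubgroup.zmultiples v)) '' latticeBox a S t =
      latticeBox (fun i => (a i : L ⧸ AddSubgroup.zmultiples v)) S t := by
  have key : ∀ x : E → ℤ, ((∑ e ∈ S, x e • a e : L) : L ⧸ AddSubgroup.zmultiples v) =
      ∑ e ∈ S, x e • (a e : L ⧸ AddSubgroup.zmultiples v) := fun x => by
    rw [← QuotientAddGroup.mk'_apply, map_sum]
    rfl
  ext l
  constructor
  · rintro ⟨_, ⟨x, hx, rfl⟩, rfl⟩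
    exact ⟨x, hx, (key x).symm⟩
  · rintro ⟨x, hx, rfl⟩
    exact ⟨_, ⟨x, hx, rfl⟩, key x⟩

lemma isIntIndep_insert [DecidableEq E] {a : E → L} {F : Finset E} {e : E} (he : e ∉ F)
    (hv : ∀ k : ℤ, k • a e = 0 → k = 0) :
    IsIntIndep a (insert e F) ↔
      IsIntIndep (fun i => (a i : L ⧸ AddSubgroup.zmultiples (a e))) F := by
  have key : ∀ x : E → ℤ, ((∑ i ∈ F, x i • a i : L) : L ⧸ AddSubgroup.zmultiples (a e)) =
      ∑ i ∈ F, x i • (a i : L ⧸ AddSubgroup.zmultiples (a e)) := fun x => by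
    rw [← QuotientAddGroup.mk'_apply, map_sum]
    rfl
  constructor
  · intro h x hx i hi
    rw [← key, QuotientAddGroup.eq_zero_iff] at hx
    obtain ⟨k, hk⟩ := AddSubgroup.mem_zmultiples_iff.1 hx
    have := h (Function.update x e (-k))
      (by rw [sum_insert_update_zsmul a he, ← hk]; simp) i (Finset.mem_insert_of_mem hi)
    rwa [Function.update_of_ne (ne_of_mem_of_not_mem hi he)] at this
  · intro h x hx
    rw [Finset.sum_insert he] at hx
    have hF : ∀ i ∈ F, x i = 0 := by
      refine h x ?_
      rw [← key, QuotientAddGroup.eq_zero_iff]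
      exact AddSubgroup.mem_zmultiples_iff.2
        ⟨-x e, by rw [neg_smul]; exact neg_eq_of_add_eq_zero_right hx⟩
    rw [Finset.sum_eq_zero (fun i hi => by rw [hF i hi, zero_smul]), add_zero] at hx
    intro i hi
    rcases Finset.mem_insert.1 hi with rfl | hi
    · exact hv _ hx
    · exact hF i hi

open Classical in
/-- The number of points of the lattice box of a regular family is the generating function of its
independent sets. -/
theorem IsRegularOn.ncard_latticeBox {E : Type*} (S : Finset E) (t : ℕ) {L : Type*}
    [AddCommGroup L] {a : E → L} (h : IsRegularOn a S) :
    (latticeBox a S t).Finite ∧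
      (latticeBox a S t).ncard = ∑ F ∈ S.powerset with IsIntIndep a F, t ^ F.card := by
  -- The group must vary, because contraction passes to the quotient by `a e`.
  induction S using Finset.induction_on generalizing L with
  | empty =>
    have : latticeBox a ∅ t = {0} := by
      ext l
      simp [latticeBox, eq_comm]
    rw [this, Finset.powerset_empty, Finset.filter_true_of_mem]
    · simp
    · intro F hF
      rw [Finset.mem_singleton] at hF
      simp [hF, IsIntIndep]
  | insert e S he ih =>
    obtain ⟨hfin, hcard⟩ := ih (h.of_insert he)
    have hnot : ∀ F ∈ S.powerset, e ∉ F := fun F hF h' => he (Finset.mem_powerset.1 hF h')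
    rw [Finset.sum_filter, Finset.sum_powerset_insert he, ← Finset.sum_filter, ← hcard,
      latticeBox_insert a he]
    -- A zero vector adds no points and lies in no independent set.
    by_cases hae : a e = 0
    · have h0 : sweep (latticeBox a S t) (a e) t = latticeBox a S t := by
        ext l
        constructor
        · rintro ⟨k, -, -, m, hm, rfl⟩
          simpa [hae] using hm
        · exact fun hl => ⟨0, le_rfl, by simp, l, hl, by simp⟩
      rw [h0]
      refine ⟨hfin, ?_⟩
      rw [Finset.sum_eq_zero, add_zero]
      intro F hF
      rw [if_neg]
      intro hi
      simpa using hi (Pi.single e 1) (by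
        refine Finset.sum_eq_zero fun i _ => ?_
        rcases eq_or_ne i e with rfl | hi
        · simp [hae]
        · simp [hi]) e (Finset.mem_insert_self _ _)
    · have hv : ∀ k : ℤ, k • a e = 0 → k = 0 := fun k =>
        h.eq_zero_of_zsmul_eq_zero (Finset.mem_insert_self _ _) hae
      obtain ⟨h1, h2⟩ := ncard_sweep hfin hv
        (fun l hl k hk hlk => h.add_mem_latticeBox he hk hl hlk) t
      refine ⟨h1, ?_⟩
      rw [h2, image_latticeBox, (ih (h.quotient he hae)).2, Finset.mul_sum, Finset.sum_filter]
      congr 1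
      refine Finset.sum_congr rfl fun F hF => ?_
      rw [isIntIndep_insert (hnot F hF) hv, Finset.card_insert_of_notMem (hnot F hF), pow_succ']

end RegularFamily

/-! ### Tensions, network matrices and the tocyclotope -/

namespace SimpleGraph

variable {V : Type*} {G : SimpleGraph V}

/-! ### Tensions, cuts and rounding -/

/-- The tension of a potential: its difference along each oriented edge. -/
def EdgeOrientation.tension {R : Type*} [Sub R] (o : G.EdgeOrientation) (p : V → R)
    (e : G.edgeSet) : R :=
  p (o.head e) - p (o.tail e)

lemma EdgeOrientation.apply_eq_of_tension_eq_zero {R : Type*} [AddGroup R]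
    (o : G.EdgeOrientation) {p : V → R} {e : G.edgeSet} (he : o.tension p e = 0) {u v : V}
    (huv : (e : Sym2 V) = s(u, v)) : p u = p v := by
  have h : p (o.head e) = p (o.tail e) := sub_eq_zero.1 he
  rcases Sym2.eq_iff.1 ((o.mk_eq e).trans huv) with ⟨h1, h2⟩ | ⟨h1, h2⟩
  · rw [← h1, ← h2, h]
  · rw [← h1, ← h2, h]

lemma IsSpanningSet.eq_of_tension_eq_zero {R : Type*} [AddGroup R] {S : Set G.edgeSet}
    (hS : G.IsSpanningSet S) (o : G.EdgeOrientation) {p : V → R}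
    (hp : ∀ e ∈ S, o.tension p e = 0) (u v : V) : p u = p v := by
  obtain ⟨T, hT, hTS⟩ := hS
  obtain ⟨w⟩ := hT.connected.preconnected u v
  induction w with
  | nil => rfl
  | cons h _ ih =>
    obtain ⟨e, he, hee⟩ := hTS ((mem_edgeSet T).2 h)
    exact (o.apply_eq_of_tension_eq_zero (hp e he) hee).trans ih

/-- A set of edges that misses no nonempty cut is spanning. -/
lemma isSpanningSet_of_tension {R : Type*} [Ring R] [Nontrivial R] [Nonempty V]
    {S : Set G.edgeSet} (o : G.EdgeOrientation)
    (h : ∀ p : V → R, (∀ e ∈ S, o.tension p e = 0) → ∀ u v, p u = p v) : G.IsSpanningSet S := by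
  classical
  set H : SimpleGraph V := fromEdgeSet (Subtype.val '' S) with hH
  have hconn : H.Connected := by
    refine ⟨fun u v => ?_⟩
    by_contra huv
    -- The indicator of a component has zero tension on `S`, so it is constant.
    have := h (fun w => if H.Reachable u w then 1 else 0) (fun e he => ?_) u v
    · simp [huv] at this
    · have hadj : H.Adj (o.tail e) (o.head e) := by
        rw [hH, fromEdgeSet_adj]
        have hG : G.Adj (o.tail e) (o.head e) := by
          rw [← mem_edgeSet, o.mk_eq]
          exact e.2
        exact ⟨⟨e, he, (o.mk_eq e).symm⟩, hG.ne⟩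
      have : H.Reachable u (o.head e) ↔ H.Reachable u (o.tail e) :=
        ⟨fun h => h.trans hadj.reachable.symm, fun h => h.trans hadj.reachable⟩
      simp [EdgeOrientation.tension, this]
  obtain ⟨T, hTH, hT⟩ := hconn.exists_isTree_le
  refine ⟨T, hT, (edgeSet_mono hTH).trans ?_⟩
  rw [hH, edgeSet_fromEdgeSet]
  exact Set.sdiff_subset

lemma Connected.isSpanningSet_univ (hG : G.Connected) : G.IsSpanningSet Set.univ := by
  obtain ⟨T, hT, h⟩ := hG.exists_isTree_le
  exact ⟨T, h, by simpa using hT⟩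

/-- The indicator of an upper level set of a potential is a cut conforming to its tension. -/
lemma EdgeOrientation.exists_conformal_cut (o : G.EdgeOrientation) {x : G.edgeSet → ℤ} {p : V → ℝ}
    (hp : ∀ e, o.tension p e = x e) (hx : ∃ e, x e ≠ 0) :
    ∃ q : V → ℤ, (∃ e, o.tension q e ≠ 0) ∧
      ∀ e, o.tension q e = 0 ∨ o.tension q e = (x e).sign := by
  classical
  obtain ⟨e, he⟩ := hx
  -- At this threshold exactly one end of `e` lies in the level set, so `e` is in the cut.
  set m := max (p (o.head e)) (p (o.tail e)) with hm
  have hne : p (o.head e) - p (o.tail e) ≠ 0 := by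
    have := hp e
    rw [EdgeOrientation.tension] at this
    rw [this]
    exact_mod_cast he
  refine ⟨fun v => if m ≤ p v then 1 else 0, ⟨e, ?_⟩, fun f => ?_⟩
  · rcases lt_or_gt_of_ne (sub_ne_zero.1 hne) with h | h
    · simp [tension, hm, h.le, h.not_ge]
    · simp [tension, hm, h.le, h.not_ge]
  · have hf := hp f
    simp only [tension] at hf ⊢
    by_cases h1 : m ≤ p (o.head f) <;> by_cases h2 : m ≤ p (o.tail f)
    · simp [h1, h2]
    · right
      have : (0 : ℝ) < x f := by linarith
      rw [Int.sign_eq_one_of_pos (by exact_mod_cast this)]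
      simp [h1, h2]
    · right
      have : (x f : ℝ) < 0 := by linarith
      rw [Int.sign_eq_neg_one_of_neg (by exact_mod_cast this)]
      simp [h1, h2]
    · simp [h1, h2]

/-- The error is a difference of two fractional parts. An integer within less than one of a real in
`[0, t]` is itself in `[0, t]`, and two integers this close are equal; integrality below rests on
these two remarks. -/
lemma EdgeOrientation.abs_tension_floor_sub_lt (o : G.EdgeOrientation) (p : V → ℝ)
    (e : G.edgeSet) :
    |((o.tension (fun v => ⌊p v⌋) e : ℤ) : ℝ) - o.tension p e| < 1 := by
  have h1 := Int.floor_le (p (o.head e))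
  have h2 := Int.lt_floor_add_one (p (o.head e))
  have h3 := Int.floor_le (p (o.tail e))
  have h4 := Int.lt_floor_add_one (p (o.tail e))
  simp only [tension]
  push_cast
  rw [abs_lt]
  constructor <;> linarith

/-! ### Network matrices and the kernel of their duals -/

section Matrices

open Matrix

variable [DecidableEq V]

lemma EdgeOrientation.vecMul_incidenceMatrix [Fintype V] (o : G.EdgeOrientation) (p : V → ℝ) :
    p ᵥ* o.incidenceMatrix = o.tension p := by
  ext e
  simp [Matrix.vecMul, dotProduct, incidenceMatrix, tension, mul_sub, Finset.sum_sub_distrib,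
    Pi.single_apply]

variable {T : Finset G.edgeSet} {W : Matrix {e // e ∈ T} {e // e ∉ T} ℝ}

lemma blockMatrix_apply_mem (i : {e // e ∈ T}) (e : {e // e ∈ T}) :
    blockMatrix T W i e = (1 : Matrix {e // e ∈ T} {e // e ∈ T} ℝ) i e := by
  simp [blockMatrix]

lemma blockMatrix_apply_notMem (i : {e // e ∈ T}) (f : {e // e ∉ T}) :
    blockMatrix T W i f = W i f := by
  simp [blockMatrix]

lemma dualBlockMatrix_apply_mem (f : {e // e ∉ T}) (e : {e // e ∈ T}) :
    dualBlockMatrix T W f e = -W e f := by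
  simp [dualBlockMatrix]

lemma dualBlockMatrix_apply_notMem (f g : {e // e ∉ T}) :
    dualBlockMatrix T W f g = (1 : Matrix {e // e ∉ T} {e // e ∉ T} ℝ) f g := by
  simp [dualBlockMatrix]

variable [Fintype G.edgeSet]

lemma sum_edgeSet_eq {M : Type*} [AddCommMonoid M] (T : Finset G.edgeSet) (g : G.edgeSet → M) :
    ∑ e, g e = ∑ e : {e // e ∈ T}, g e + ∑ f : {e // e ∉ T}, g f := by
  rw [← Fintype.sum_subtype_add_sum_subtype (· ∈ T) g]
  congr!

lemma dualBlockMatrix_mulVec (x : G.edgeSet → ℝ) (f : {e // e ∉ T}) :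
    (dualBlockMatrix T W *ᵥ x) f = x f - ∑ e : {e // e ∈ T}, x e * W e f := by
  rw [Matrix.mulVec, dotProduct, sum_edgeSet_eq T]
  simp only [dualBlockMatrix_apply_mem, dualBlockMatrix_apply_notMem, Matrix.one_apply, ite_mul,
    one_mul, zero_mul, neg_mul, Finset.sum_neg_distrib, Finset.sum_ite_eq, Finset.mem_univ,
    if_true]
  simp only [mul_comm]
  ring

omit [Fintype G.edgeSet] in
lemma vecMul_blockMatrix_mem (y : {e // e ∈ T} → ℝ) (e : {e // e ∈ T}) :
    (y ᵥ* blockMatrix T W) e = y e := by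
  simp [Matrix.vecMul, dotProduct, blockMatrix_apply_mem, Matrix.one_apply]

omit [Fintype G.edgeSet] in
lemma vecMul_blockMatrix_notMem (y : {e // e ∈ T} → ℝ) (f : {e // e ∉ T}) :
    (y ᵥ* blockMatrix T W) f = ∑ e, y e * W e f := by
  simp [Matrix.vecMul, dotProduct, blockMatrix_apply_notMem]

/-- A vector in the row space of `[W | I]` is determined by its coordinates in `T`, and `[I | -Wᵀ] x
= 0` says that the other coordinates are the ones so determined. -/
lemma dualBlockMatrix_mulVec_eq_zero_iff (x : G.edgeSet → ℝ) :
    dualBlockMatrix T W *ᵥ x = 0 ↔ ∃ y, y ᵥ* blockMatrix T W = x := by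
  constructor
  · intro h
    refine ⟨fun e => x e, funext fun f => ?_⟩
    by_cases hf : f ∈ T
    · exact vecMul_blockMatrix_mem _ ⟨f, hf⟩
    · have := congrFun h ⟨f, hf⟩
      rw [dualBlockMatrix_mulVec, Pi.zero_apply, sub_eq_zero] at this
      exact (vecMul_blockMatrix_notMem _ ⟨f, hf⟩).trans this.symm
  · rintro ⟨y, rfl⟩
    ext f
    rw [dualBlockMatrix_mulVec, vecMul_blockMatrix_notMem]
    simp [vecMul_blockMatrix_mem]

variable [Fintype V] {o : G.EdgeOrientation}

-- Invertible row operations preserve the row space, and the row space of the incidence matrix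
-- consists of the tensions.
omit [Fintype G.edgeSet] in
lemma EdgeOrientation.IsNetworkMatrix.exists_vecMul_eq_iff (h : o.IsNetworkMatrix T W)
    (x : G.edgeSet → ℝ) :
    (∃ y, y ᵥ* blockMatrix T W = x) ↔ ∃ p, o.tension p = x := by
  obtain ⟨U, r, hU, h⟩ := h
  have key : ∀ q : V → ℝ, q ᵥ* (U * o.incidenceMatrix) =
      (fun e => q (r (.inl e))) ᵥ* blockMatrix T W := by
    intro q
    ext f
    have h1 : ∀ i, (U * o.incidenceMatrix) (r i) f =
        (Matrix.fromRows (blockMatrix T W) (0 : Matrix Unit G.edgeSet ℝ)) i f := fun i => by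
      rw [← h]
      rfl
    simp only [Matrix.vecMul, dotProduct]
    rw [← r.sum_comp, Fintype.sum_sum_type]
    simp [h1]
  constructor
  · rintro ⟨y, rfl⟩
    refine ⟨(fun v => Sum.elim y 0 (r.symm v)) ᵥ* U, ?_⟩
    rw [← o.vecMul_incidenceMatrix, Matrix.vecMul_vecMul, key]
    simp
  · rintro ⟨p, rfl⟩
    refine ⟨fun e => (p ᵥ* U⁻¹) (r (.inl e)), ?_⟩
    rw [← key, Matrix.vecMul_vecMul, ← Matrix.mul_assoc,
      Matrix.nonsing_inv_mul _ ((Matrix.isUnit_iff_isUnit_det _).1 hU), Matrix.one_mul,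
      o.vecMul_incidenceMatrix]

/-- The kernel of `[I | -Wᵀ]` is the space of tensions. -/
lemma EdgeOrientation.IsNetworkMatrix.mulVec_eq_zero_iff (h : o.IsNetworkMatrix T W)
    (x : G.edgeSet → ℝ) :
    dualBlockMatrix T W *ᵥ x = 0 ↔ ∃ p, o.tension p = x := by
  rw [dualBlockMatrix_mulVec_eq_zero_iff, h.exists_vecMul_eq_iff]

omit [Fintype G.edgeSet] in
/-- Network matrices are integral. -/
lemma EdgeOrientation.IsNetworkMatrix.exists_int (h : o.IsNetworkMatrix T W)
    (e : {e // e ∈ T}) (f : {e // e ∉ T}) : ∃ z : ℤ, W e f = z := by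
  obtain ⟨p, hp⟩ := (h.exists_vecMul_eq_iff (Pi.single e 1 ᵥ* blockMatrix T W)).1 ⟨_, rfl⟩
  obtain ⟨y, hy⟩ := (h.exists_vecMul_eq_iff _).2 ⟨fun v => (⌊p v⌋ : ℝ), rfl⟩
  -- Row `e` is a tension with values `0` and `1` on `T`, so rounding its potential leaves these
  -- values unchanged. They determine the row, which therefore equals the rounded, integral tension.
  have hye : y = Pi.single e 1 := by
    ext i
    have h1 : y i = o.tension (fun v => (⌊p v⌋ : ℝ)) i := by
      rw [← hy, vecMul_blockMatrix_mem]
    have h2 : o.tension p i = (Pi.single e 1 : _ → ℝ) i := by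
      rw [hp, vecMul_blockMatrix_mem]
    have h3 := o.abs_tension_floor_sub_lt p i
    have h4 : ((o.tension (fun v => ⌊p v⌋) i : ℤ) : ℝ) = y i := by
      rw [h1]
      simp [EdgeOrientation.tension]
    rw [h2] at h3
    rw [← h4]
    have h5 : (Pi.single e 1 : _ → ℝ) i = (((Pi.single e 1 : _ → ℤ) i : ℤ) : ℝ) := by
      rcases eq_or_ne i e with rfl | hi <;> simp [*]
    rw [h5] at h3 ⊢
    have h6 : |o.tension (fun v => ⌊p v⌋) i - (Pi.single e 1 : _ → ℤ) i| < 1 := by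
      exact_mod_cast h3
    rw [Int.abs_lt_one_iff, sub_eq_zero] at h6
    rw [h6]
  refine ⟨o.tension (fun v => ⌊p v⌋) f, ?_⟩
  have h7 := congrFun hy f
  rw [vecMul_blockMatrix_notMem, hye] at h7
  simpa [EdgeOrientation.tension, Pi.single_apply] using h7

omit [Fintype V] in
lemma sum_smul_col_eq {R : Type*} [Ring R] [Module R ℝ] (c : R → ℝ)
    (hc : ∀ (r : R) (y : ℝ), r • y = c r * y) (x : G.edgeSet → R) (F : Finset G.edgeSet)
    (hF : ∀ e ∉ F, x e = 0) :
    ∑ e ∈ F, x e • (dualBlockMatrix T W).col e = dualBlockMatrix T W *ᵥ fun e => c (x e) := by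
  rw [Finset.sum_subset (Finset.subset_univ F) fun e _ he => by rw [hF e he, zero_smul]]
  ext f
  simp [Matrix.mulVec, dotProduct, Finset.sum_apply, hc, mul_comm]

omit [Fintype V] in
lemma sum_zsmul_col_eq (x : G.edgeSet → ℤ) (F : Finset G.edgeSet) (hF : ∀ e ∉ F, x e = 0) :
    ∑ e ∈ F, x e • (dualBlockMatrix T W).col e = dualBlockMatrix T W *ᵥ fun e => (x e : ℝ) :=
  sum_smul_col_eq _ (fun r y => zsmul_eq_mul y r) x F hF

lemma EdgeOrientation.IsNetworkMatrix.isRegularOn (h : o.IsNetworkMatrix T W) :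
    IsRegularOn (dualBlockMatrix T W).col Finset.univ := by
  intro x hx ⟨e, _, he⟩
  rw [sum_zsmul_col_eq _ _ (by simp), h.mulVec_eq_zero_iff] at hx
  obtain ⟨p, hp⟩ := hx
  obtain ⟨q, ⟨i, hi⟩, hq⟩ := o.exists_conformal_cut (congrFun hp) ⟨e, he⟩
  refine ⟨o.tension q, ⟨i, Finset.mem_univ _, hi⟩, fun e _ => hq e, ?_⟩
  rw [sum_zsmul_col_eq _ _ (by simp), h.mulVec_eq_zero_iff]
  exact ⟨fun v => q v, by ext e; simp [EdgeOrientation.tension]⟩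

lemma EdgeOrientation.IsNetworkMatrix.linearIndependent_of_isSpanningSet
    (h : o.IsNetworkMatrix T W) {F : Finset G.edgeSet}
    (hF : G.IsSpanningSet (F : Set G.edgeSet)ᶜ) :
    LinearIndependent ℝ (fun e : F => (dualBlockMatrix T W).col (e : G.edgeSet)) := by
  rw [Fintype.linearIndependent_iff]
  intro g hg
  set x : G.edgeSet → ℝ := fun e => if he : e ∈ F then g ⟨e, he⟩ else 0 with hx
  have hxF : ∀ e ∉ F, x e = 0 := fun e he => dif_neg he
  have hxg : ∀ e : F, x e = g e := fun e => dif_pos e.2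
  have h0 : ∑ e ∈ F, x e • (dualBlockMatrix T W).col e = 0 := by
    rw [← hg, ← Finset.sum_coe_sort F]
    exact Finset.sum_congr rfl fun e _ => by rw [hxg]
  rw [sum_smul_col_eq id (fun _ _ => rfl) x F hxF] at h0
  obtain ⟨p, hp⟩ := (h.mulVec_eq_zero_iff _).1 h0
  intro e
  have hpc := hF.eq_of_tension_eq_zero o (p := p) fun e he => by
    rw [hp]
    exact hxF e he
  rw [← hxg, ← id_def (x e), ← congrFun hp e, EdgeOrientation.tension, hpc, sub_self]

lemma EdgeOrientation.IsNetworkMatrix.isSpanningSet_of_isIntIndep (hG : G.Connected)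
    (h : o.IsNetworkMatrix T W) {F : Finset G.edgeSet}
    (hF : IsIntIndep (dualBlockMatrix T W).col F) : G.IsSpanningSet (F : Set G.edgeSet)ᶜ := by
  have := hG.nonempty
  refine isSpanningSet_of_tension (R := ℤ) o fun p hp => ?_
  have h0 := hF (o.tension p) (by
    rw [sum_zsmul_col_eq _ _ fun e he => hp e (by simpa using he), h.mulVec_eq_zero_iff]
    exact ⟨fun v => p v, by ext e; simp [EdgeOrientation.tension]⟩)
  refine fun u v => hG.isSpanningSet_univ.eq_of_tension_eq_zero o (fun e _ => ?_) u v
  by_cases he : e ∈ F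
  · exact h0 e he
  · exact hp e (by simpa using he)

omit [Fintype G.edgeSet] [Fintype V] in
lemma isIntIndep_of_linearIndependent {F : Finset G.edgeSet}
    (hF : LinearIndependent ℝ (fun e : F => (dualBlockMatrix T W).col (e : G.edgeSet))) :
    IsIntIndep (dualBlockMatrix T W).col F := by
  intro x hx e he
  have := linearIndependent_iff'.1 hF Finset.univ (fun e => (x e : ℝ)) (by
    rw [← hx, ← Finset.sum_coe_sort F]
    exact Finset.sum_congr rfl fun e _ => Int.cast_smul_eq_zsmul ℝ _ _) ⟨e, he⟩ (Finset.mem_univ _)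
  exact_mod_cast this

lemma EdgeOrientation.IsNetworkMatrix.linearIndependent_iff (hG : G.Connected)
    (h : o.IsNetworkMatrix T W) (F : Finset G.edgeSet) :
    LinearIndependent ℝ (fun e : F => (dualBlockMatrix T W).col (e : G.edgeSet)) ↔
      G.IsSpanningSet (F : Set G.edgeSet)ᶜ :=
  ⟨fun hF => h.isSpanningSet_of_isIntIndep hG (isIntIndep_of_linearIndependent hF),
    h.linearIndependent_of_isSpanningSet⟩

lemma EdgeOrientation.IsNetworkMatrix.isIntIndep_iff (hG : G.Connected)
    (h : o.IsNetworkMatrix T W) (F : Finset G.edgeSet) :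
    IsIntIndep (dualBlockMatrix T W).col F ↔ G.IsSpanningSet (F : Set G.edgeSet)ᶜ :=
  ⟨h.isSpanningSet_of_isIntIndep hG,
    fun hF => isIntIndep_of_linearIndependent (h.linearIndependent_of_isSpanningSet hF)⟩

open scoped Pointwise in
/-- The lattice points of a dilated tocyclotope are the images of the lattice points of the
dilated cube. -/
lemma EdgeOrientation.IsNetworkMatrix.smul_zonotope_inter_integerPoints
    (h : o.IsNetworkMatrix T W) {t : ℕ} (ht : 0 < t) :
    ((t : ℝ) • zonotope (dualBlockMatrix T W)) ∩ integerPoints {e // e ∉ T} =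
      latticeBox (dualBlockMatrix T W).col Finset.univ t := by
  have ht' : (0 : ℝ) < t := by exact_mod_cast ht
  ext l
  constructor
  · rintro ⟨⟨_, ⟨x, hx, rfl⟩, rfl⟩, z, hz⟩
    dsimp only at hz ⊢
    -- An integer preimage of the lattice point, read off from the identity block. It may leave the
    -- cube; the tension of a rounded potential corrects this, keeping each coordinate within less
    -- than one of `t * x e`.
    set x₀ : G.edgeSet → ℤ := fun e => if he : e ∈ T then 0 else z ⟨e, he⟩ with hx₀
    have h0 : dualBlockMatrix T W *ᵥ (fun e => (x₀ e : ℝ)) = (t : ℝ) • dualBlockMatrix T W *ᵥ x := by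
      rw [← hz]
      ext f
      rw [dualBlockMatrix_mulVec, Finset.sum_eq_zero fun e _ => by simp [hx₀]]
      simp [hx₀, f.2]
    obtain ⟨p, hp⟩ := (h.mulVec_eq_zero_iff ((t : ℝ) • x - fun e => (x₀ e : ℝ))).1 (by
      rw [Matrix.mulVec_sub, h0, Matrix.mulVec_smul, sub_self])
    refine ⟨fun e => x₀ e + o.tension (fun v => ⌊p v⌋) e, fun e _ => ?_, ?_⟩
    · have h1 := o.abs_tension_floor_sub_lt p e
      have h2 : 0 ≤ (t : ℝ) * x e := mul_nonneg ht'.le (hx.1 e)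
      have h3 : (t : ℝ) * x e ≤ t := mul_le_of_le_one_right ht'.le (hx.2 e)
      have h4 : o.tension p e = t * x e - x₀ e := congrFun hp e
      rw [h4, abs_lt] at h1
      constructor
      · refine Int.lt_add_one_iff.1 ?_
        have : (0 : ℝ) < x₀ e + (o.tension (fun v => ⌊p v⌋) e : ℤ) + 1 := by linarith [h1.1]
        exact_mod_cast this
      · refine Int.lt_add_one_iff.1 ?_
        have : (x₀ e + (o.tension (fun v => ⌊p v⌋) e : ℤ) : ℝ) < t + 1 := by linarith [h1.2]
        exact_mod_cast this
    · rw [sum_zsmul_col_eq _ _ (by simp), ← h0, ← sub_eq_zero, ← Matrix.mulVec_sub,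
        h.mulVec_eq_zero_iff]
      refine ⟨fun v => (⌊p v⌋ : ℝ), ?_⟩
      ext e
      simp [EdgeOrientation.tension]
  · rintro ⟨x, hx, rfl⟩
    rw [sum_zsmul_col_eq _ _ (by simp)]
    constructor
    · refine ⟨_, ⟨fun e => (t : ℝ)⁻¹ * x e, ⟨fun e => ?_, fun e => ?_⟩, rfl⟩, ?_⟩
      · have : (0 : ℝ) ≤ x e := by exact_mod_cast (hx e (Finset.mem_univ _)).1
        exact mul_nonneg (inv_nonneg.2 ht'.le) this
      · have : (x e : ℝ) ≤ t := by exact_mod_cast (hx e (Finset.mem_univ _)).2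
        exact inv_mul_le_one_of_le₀ this ht'.le
      · dsimp only
        rw [← Matrix.mulVec_smul]
        congr 1
        ext e
        simp [ht'.ne']
    · choose w hw using h.exists_int
      refine ⟨fun f => x f - ∑ e : {e // e ∈ T}, x e * w e f, ?_⟩
      ext f
      rw [dualBlockMatrix_mulVec]
      simp [hw]

/-! ### Ehrhart polynomial and existence of network matrices -/

omit [Fintype G.edgeSet] in
lemma EdgeOrientation.IsNetworkMatrix.card_add_one (h : o.IsNetworkMatrix T W) :
    T.card + 1 = Fintype.card V := by
  obtain ⟨_, r, -⟩ := h
  simpa using Fintype.card_congr r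

lemma EdgeOrientation.IsNetworkMatrix.card_le_of_linearIndependent (h : o.IsNetworkMatrix T W)
    {F : Finset G.edgeSet}
    (hF : LinearIndependent ℝ (fun e : F => (dualBlockMatrix T W).col (e : G.edgeSet))) :
    F.card ≤ Fintype.card G.edgeSet + 1 - Fintype.card V := by
  have h1 := hF.fintype_card_le_finrank
  rw [Module.finrank_fintype_fun_eq_card, Fintype.card_coe, Fintype.card_subtype_compl,
    Fintype.card_coe] at h1
  have := h.card_add_one
  omega

omit [DecidableEq V] [Fintype V] in
open Classical in
lemma numCospanning_eq_card (G : SimpleGraph V) [Fintype G.edgeSet] (k : ℕ) :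
    G.numCospanning k =
      (Finset.univ.filter fun F : Finset G.edgeSet =>
        F.card = k ∧ G.IsSpanningSet (F : Set G.edgeSet)ᶜ).card := by
  rw [numCospanning, ← Set.ncard_coe_finset]
  simp

/-- The Ehrhart polynomial of the tocyclotope. -/
theorem EdgeOrientation.IsNetworkMatrix.isEhrhartPolynomial (hG : G.Connected)
    (h : o.IsNetworkMatrix T W) :
    IsEhrhartPolynomial (zonotope (dualBlockMatrix T W))
      (∑ k ∈ Finset.range (Fintype.card G.edgeSet + 1 - Fintype.card V + 1),
        Polynomial.C (G.numCospanning k : ℝ) * Polynomial.X ^ k) := by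
  classical
  intro t ht
  rw [h.smul_zonotope_inter_integerPoints ht]
  obtain ⟨h1, h2⟩ := h.isRegularOn.ncard_latticeBox Finset.univ t
  refine ⟨h1, ?_⟩
  rw [h2, Polynomial.eval_finsetSum]
  simp only [Polynomial.eval_mul, Polynomial.eval_C, Polynomial.eval_pow, Polynomial.eval_X,
    h.isIntIndep_iff hG, Finset.powerset_univ]
  rw [← Finset.sum_fiberwise_of_maps_to (g := Finset.card)
    (t := Finset.range (Fintype.card G.edgeSet + 1 - Fintype.card V + 1))]
  · push_cast
    refine Finset.sum_congr rfl fun k _ => ?_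
    rw [numCospanning_eq_card, Finset.filter_filter, Finset.sum_congr rfl fun F hF => by
      rw [(Finset.mem_filter.1 hF).2.2], Finset.sum_const, nsmul_eq_mul]
    simp only [and_comm]
  · intro F hF
    rw [Finset.mem_range, Nat.lt_succ_iff]
    exact h.card_le_of_linearIndependent ((h.linearIndependent_iff hG F).2 (Finset.mem_filter.1 hF).2)

omit [Fintype G.edgeSet] in
/-- A spanning tree gives a network matrix. -/
theorem EdgeOrientation.exists_isNetworkMatrix [Finite G.edgeSet] (hG : G.Connected)
    (o : G.EdgeOrientation) :
    ∃ (T : Finset G.edgeSet) (W : Matrix {e // e ∈ T} {e // e ∉ T} ℝ), o.IsNetworkMatrix T W := by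
  classical
  have := hG.nonempty
  have : Fintype G.edgeSet := Fintype.ofFinite _
  obtain ⟨T', hT'G, hT'⟩ := hG.exists_isTree_le
  set T : Finset G.edgeSet := Finset.univ.filter fun e => (e : Sym2 V) ∈ T'.edgeSet with hT
  have hmem : ∀ e, e ∈ T ↔ (e : Sym2 V) ∈ T'.edgeSet := fun e => by simp [hT]
  have hspan : G.IsSpanningSet (T : Set G.edgeSet) :=
    ⟨T', hT', fun e he => ⟨⟨e, edgeSet_mono hT'G he⟩, (hmem _).2 he, rfl⟩⟩
  have hcard : T.card + 1 = Fintype.card V := by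
    rw [← hT'.card_edgeFinset, add_left_inj, ← Finset.card_map (Function.Embedding.subtype _)]
    congr 1
    ext e
    simp only [Finset.mem_map, hmem, Function.Embedding.subtype_apply, mem_edgeFinset]
    exact ⟨by rintro ⟨e, he, rfl⟩; exact he, fun he => ⟨⟨e, edgeSet_mono hT'G he⟩, he, rfl⟩⟩
  have r : {e // e ∈ T} ⊕ Unit ≃ V := Fintype.equivOfCardEq (by simpa using hcard)
  let v₀ : V := Classical.arbitrary V
  -- `B` sends a potential to its tensions on the tree and its value at `v₀`. It is injective, as
  -- zero tension on a spanning tree forces a constant potential. The columns of `B⁻¹` are the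
  -- potentials dual to these data; as rows of `B⁻¹ᵀ` they yield the identity block, and the
  -- constant one yields the zero row.
  let B : Matrix V V ℝ := fun w v =>
    Sum.elim (fun e : {e // e ∈ T} => o.incidenceMatrix v e)
      (fun _ => (Pi.single v₀ 1 : V → ℝ) v) (r.symm w)
  have hBl : ∀ (p : V → ℝ) (e : {e // e ∈ T}), (B *ᵥ p) (r (.inl e)) = o.tension p e := by
    intro p e
    rw [← o.vecMul_incidenceMatrix]
    simp [B, Matrix.mulVec, Matrix.vecMul, dotProduct, mul_comm]
  have hBr : ∀ p : V → ℝ, (B *ᵥ p) (r (.inr ())) = p v₀ := by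
    intro p
    simp [B, Matrix.mulVec, dotProduct, Pi.single_apply]
  have hB : IsUnit B := by
    rw [← Matrix.mulVec_injective_iff_isUnit]
    refine (injective_iff_map_eq_zero B.mulVecLin).2 fun p hp => ?_
    have hp' : B *ᵥ p = 0 := hp
    have hc := hspan.eq_of_tension_eq_zero o (p := p) fun e he => by
      rw [← hBl p ⟨e, he⟩, hp']
      rfl
    ext v
    rw [hc v v₀, ← hBr p, hp']
    rfl
  have hBdet := (Matrix.isUnit_iff_isUnit_det _).1 hB
  have hBU : ∀ w, B *ᵥ (B⁻¹ᵀ w) = Pi.single w 1 := by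
    intro w
    have h1 : B⁻¹ᵀ w = B⁻¹ *ᵥ Pi.single w 1 := by
      ext v
      simp
    rw [h1, Matrix.mulVec_mulVec, Matrix.mul_nonsing_inv _ hBdet, Matrix.one_mulVec]
  have hrow : ∀ w e, (B⁻¹ᵀ * o.incidenceMatrix) w e = o.tension (B⁻¹ᵀ w) e := fun w e => by
    rw [← o.vecMul_incidenceMatrix, Matrix.mul_apply_eq_vecMul]
  refine ⟨T, fun e f => o.tension (B⁻¹ᵀ (r (.inl e))) f, B⁻¹ᵀ, r, ?_, ?_⟩
  · rw [Matrix.isUnit_transpose]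
    exact (Matrix.isUnit_nonsing_inv_iff).2 hB
  · ext i f
    rw [Matrix.submatrix_apply, hrow, id_eq]
    rcases i with e | _
    · rw [Matrix.fromRows_apply_inl]
      by_cases hf : f ∈ T
      · have h1 := hBl (B⁻¹ᵀ (r (.inl e))) ⟨f, hf⟩
        rw [hBU] at h1
        rw [← h1]
        have h2 := blockMatrix_apply_mem (T := T)
          (W := fun e f => o.tension (B⁻¹ᵀ (r (.inl e))) f) e ⟨f, hf⟩
        refine Eq.trans ?_ h2.symm
        simp only [Matrix.one_apply, Pi.single_apply, r.apply_eq_iff_eq, Sum.inl.injEq, eq_comm]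
      · exact (blockMatrix_apply_notMem (T := T)
          (W := fun e f => o.tension (B⁻¹ᵀ (r (.inl e))) f) e ⟨f, hf⟩).symm
    · have hc := hspan.eq_of_tension_eq_zero o (p := B⁻¹ᵀ (r (.inr ()))) fun e he => by
        rw [← hBl _ ⟨e, he⟩, hBU]
        simp
      rw [EdgeOrientation.tension, hc, sub_self]
      rfl

end Matrices

end SimpleGraph

/-! ### Cycles and cuts -/

section CyclesAndCuts

open SimpleGraph

open Classical in
/-- The indicator of a set of vertices, modulo two. -/
noncomputable def sideIndicator {α : Type*} (X : Set α) (v : α) : ZMod 2 := if v ∈ X then 1 else 0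

lemma sideIndicator_add_eq_one_iff {α : Type*} {X : Set α} {u v : α} :
    sideIndicator X u + sideIndicator X v = 1 ↔ (u ∈ X ∧ v ∉ X ∨ u ∉ X ∧ v ∈ X) := by
  unfold sideIndicator
  by_cases hu : u ∈ X <;> by_cases hv : v ∈ X <;> simp [hu, hv, CharTwo.add_self_eq_zero]

lemma sideIndicator_add_eq_zero_iff {α : Type*} {X : Set α} {u v : α} :
    sideIndicator X u + sideIndicator X v = 0 ↔ ¬(u ∈ X ∧ v ∉ X ∨ u ∉ X ∧ v ∈ X) := by
  unfold sideIndicator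
  by_cases hu : u ∈ X <;> by_cases hv : v ∈ X <;> simp [hu, hv, CharTwo.add_self_eq_zero]

/-! ### Cycles, cuts and bonds of a multigraph -/

namespace Graph

variable {α β : Type*} {H : Graph α β}

lemma IsLink.mem_cut_iff {e : β} {x y : α} (h : H.IsLink e x y) {X : Set α} :
    e ∈ H.cut X ↔ (x ∈ X ∧ y ∉ X ∨ x ∉ X ∧ y ∈ X) := by
  constructor
  · rintro ⟨u, hu, v, hv, huv⟩
    rcases h.eq_and_eq_or_eq_and_eq huv with ⟨rfl, rfl⟩ | ⟨rfl, rfl⟩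
    · exact .inl ⟨hu, hv⟩
    · exact .inr ⟨hv, hu⟩
  · rintro (⟨hx, hy⟩ | ⟨hx, hy⟩)
    · exact ⟨x, hx, y, hy, h⟩
    · exact ⟨y, hy, x, hx, h.symm⟩

/-- A cycle and a cut do not meet in exactly one edge. -/
lemma IsCycleEdgeSet.inter_cut_ne_singleton {C : Set β} (hC : H.IsCycleEdgeSet C) (X : Set α)
    (e : β) : C ∩ H.cut X ≠ {e} := by
  obtain ⟨n, _, v, f, hv, hf, hlink, rfl⟩ := hC
  intro h
  obtain ⟨⟨i, rfl⟩, hi⟩ : e ∈ Set.range f ∩ H.cut X := h ▸ rfl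
  -- Every vertex of the cycle is counted twice.
  have hsum : ∑ j, (sideIndicator X (v j) + sideIndicator X (v (j + 1))) = 0 := by
    rw [Finset.sum_add_distrib,
      Fintype.sum_equiv (Equiv.addRight (1 : Fin n)) (fun j => sideIndicator X (v (j + 1)))
        (fun j => sideIndicator X (v j)) fun _ => rfl]
    exact CharTwo.add_self_eq_zero _
  rw [Finset.sum_eq_single_of_mem i (Finset.mem_univ _) fun j _ hj =>
    sideIndicator_add_eq_zero_iff.2 fun hj' => hj ?_] at hsum
  · rw [sideIndicator_add_eq_one_iff.2 ((hlink i).mem_cut_iff.1 hi)] at hsum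
    exact one_ne_zero hsum
  · exact hf (Set.eq_of_mem_singleton
      (h ▸ (⟨⟨j, rfl⟩, (hlink j).mem_cut_iff.2 hj'⟩ : f j ∈ Set.range f ∩ H.cut X)))

lemma cut_diff_eq_cut {X Y : Set α} (h : H.cut Y ⊆ H.cut X) :
    H.cut X \ H.cut Y = H.cut (symmDiff X Y) := by
  ext e
  by_cases he : e ∈ H.edgeSet
  · obtain ⟨x, y, hxy⟩ := H.exists_isLink_of_mem_edgeSet he
    have := @h e
    rw [hxy.mem_cut_iff, hxy.mem_cut_iff] at this
    rw [Set.mem_sdiff, hxy.mem_cut_iff, hxy.mem_cut_iff, hxy.mem_cut_iff, Set.mem_symmDiff,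
      Set.mem_symmDiff]
    tauto
  · have h1 : ∀ Z, e ∉ H.cut Z := fun Z ⟨x, _, y, _, hxy⟩ => he hxy.edge_mem
    simp [h1]

/-- Every edge of a finite cut lies in a bond that is contained in the cut. -/
lemma exists_isBond_subset_cut [Finite β] {X : Set α} {e : β} (he : e ∈ H.cut X) :
    ∃ B ⊆ H.cut X, e ∈ B ∧ H.IsBond B := by
  -- Minimality is taken among cuts through `e`. A nonempty smaller cut missing `e` could be
  -- subtracted, leaving a smaller cut through `e`.
  obtain ⟨B, hBX, hB⟩ := (Set.toFinite {B : Set β | e ∈ B ∧ ∃ Y, B = H.cut Y}).exists_le_minimal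
    (a := H.cut X) ⟨he, X, rfl⟩
  obtain ⟨⟨heB, Y, rfl⟩, hmin⟩ := hB
  refine ⟨_, hBX, heB, ⟨⟨e, heB⟩, Y, rfl⟩, ?_⟩
  rintro _ ⟨hne, Z, rfl⟩ hZY
  by_cases heZ : e ∈ H.cut Z
  · exact hmin ⟨heZ, Z, rfl⟩ hZY
  · have h1 := hmin (y := H.cut Y \ H.cut Z) ⟨⟨heB, heZ⟩, _, cut_diff_eq_cut hZY⟩ Set.sdiff_subset
    obtain ⟨f, hf⟩ := hne
    exact absurd hf (h1 (hZY hf)).2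

/-- An edge of a set `D` lies in a cycle within `D`, or in a cut containing no other edge
of `D`. -/
lemma exists_isCycleEdgeSet_or_cut {D : Set β} {e : β} (he : e ∈ D) (heH : e ∈ H.edgeSet) :
    (∃ C ⊆ D, H.IsCycleEdgeSet C) ∨ ∃ X, D ∩ H.cut X = {e} := by
  obtain ⟨x, y, hxy⟩ := H.exists_isLink_of_mem_edgeSet heH
  -- If `e` were removed from `D`, its ends would either still be joined by a path, which `e` closes
  -- to a cycle, or be separated by a component, whose cut meets `D` only in `e`.
  let K : SimpleGraph α := SimpleGraph.fromRel fun a b => ∃ f ∈ D \ {e}, H.IsLink f a b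
  have hK : ∀ {a b}, K.Adj a b → ∃ f ∈ D \ {e}, H.IsLink f a b := by
    intro a b hab
    rcases (SimpleGraph.fromRel_adj _ _ _).1 hab with ⟨_, h | ⟨f, hf, h⟩⟩
    · exact h
    · exact ⟨f, hf, h.symm⟩
  by_cases hr : K.Reachable x y
  · left
    obtain ⟨p, hp⟩ := hr.exists_isPath
    have hadj : ∀ i : Fin (p.length + 1), i ≠ Fin.last _ →
        ∃ f ∈ D \ {e}, H.IsLink f (p.getVert i) (p.getVert (i + 1)) := fun i hi =>
      hK (p.adj_getVert_succ (Fin.val_lt_last hi))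
    have : Nonempty β := ⟨e⟩
    choose! f hfD hf using hadj
    -- At the last index `i + 1` wraps around to `0`, and `e` closes the path. A path of length `0`
    -- makes `e` a loop.
    have hlink : ∀ i, H.IsLink (if i = Fin.last _ then e else f i) (p.getVert i)
        (p.getVert ((i + 1 : Fin (p.length + 1)) : ℕ)) := by
      intro i
      split_ifs with hi
      · subst hi
        simpa using hxy.symm
      · rw [Fin.val_add_one, if_neg hi]
        exact hf i hi
    have hinj : Function.Injective fun i : Fin (p.length + 1) => p.getVert i := fun i j hij =>
      Fin.ext (hp.getVert_injOn (Nat.lt_succ_iff.1 i.2) (Nat.lt_succ_iff.1 j.2) hij)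
    refine ⟨_, ?_, p.length + 1, inferInstance, fun i => p.getVert i,
      fun i => if i = Fin.last _ then e else f i, hinj, ?_, hlink, rfl⟩
    · rintro _ ⟨i, rfl⟩
      dsimp only
      split_ifs with hi
      · exact he
      · exact (hfD i hi).1
    · intro i j hij
      dsimp only at hij
      split_ifs at hij with hi hj hj
      · exact hi.trans hj.symm
      · exact absurd hij.symm (hfD j hj).2
      · exact absurd hij (hfD i hi).2
      · have h1 := hf i hi
        rw [hij] at h1
        have hi' := Fin.val_lt_last hi
        have hj' := Fin.val_lt_last hj
        -- If an edge served two indices with ends swapped, then `i = j + 1` and `i + 1 = j`.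
        rcases h1.eq_and_eq_or_eq_and_eq (hf j hj) with ⟨h2, -⟩ | ⟨h2, h3⟩
        · exact hinj h2
        · have h4 := hp.getVert_injOn (Set.mem_ofPred.2 hi'.le) (Set.mem_ofPred.2 hj') h2
          have h5 := hp.getVert_injOn (Set.mem_ofPred.2 hi') (Set.mem_ofPred.2 hj'.le) h3
          omega
  · right
    refine ⟨{v | K.Reachable x v}, Set.eq_singleton_iff_unique_mem.2 ⟨⟨he, ?_⟩, ?_⟩⟩
    · exact ⟨x, SimpleGraph.Reachable.refl x, y, hr, hxy⟩
    · rintro g ⟨hgD, u, hu, v, hv, huv⟩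
      by_contra hge
      refine hv (hu.trans (SimpleGraph.Adj.reachable ?_))
      refine (SimpleGraph.fromRel_adj _ _ _).2 ⟨?_, .inl ⟨g, ⟨hgD, hge⟩, huv⟩⟩
      rintro rfl
      exact hv hu

end Graph

/-! ### Parity in `G` and forests of the dual graph -/

namespace SimpleGraph

variable {V : Type*} {G : SimpleGraph V}

/-- The sum along a walk, modulo two, of the number of crossings of a cut. -/
lemma Walk.sum_sideIndicator {u v : V} (p : G.Walk u v) (X : Set V) :
    (p.darts.map fun d => sideIndicator X d.fst + sideIndicator X d.snd).sum =
      sideIndicator X u + sideIndicator X v := by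
  induction p with
  | nil => simpa using (CharTwo.add_self_eq_zero _).symm
  | @cons u v w h p ih =>
    rw [Walk.darts_cons, List.map_cons, List.sum_cons, ih]
    linear_combination CharTwo.add_self_eq_zero (sideIndicator X v)

/-- A closed walk crosses a cut an even number of times, and a cycle uses each edge only once. -/
lemma Walk.IsCycle.not_unique_crossing {v : V} {p : G.Walk v v} (hp : p.IsCycle) (X : Set V)
    {a b : V} (hab : s(a, b) ∈ p.edges) (ha : a ∈ X) (hb : b ∉ X)
    (huniq : ∀ c d, s(c, d) ∈ p.edges → c ∈ X → d ∉ X → s(c, d) = s(a, b)) : False := by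
  classical
  have hnd : p.darts.Nodup := List.Nodup.of_map _ hp.isTrail.edges_nodup
  have hsum := p.sum_sideIndicator X
  rw [← List.sum_toFinset _ hnd] at hsum
  obtain ⟨d, hd, hde⟩ := List.mem_map.1 hab
  have hinj : ∀ d' ∈ p.darts, d'.edge = d.edge → d' = d := fun d' hd' h =>
    List.inj_on_of_nodup_map hp.isTrail.edges_nodup hd' hd h
  rw [Finset.sum_eq_single_of_mem d (by simpa using hd), CharTwo.add_self_eq_zero,
    sideIndicator_add_eq_zero_iff] at hsum
  · apply hsum
    rcases Sym2.eq_iff.1 (hde : s(d.fst, d.snd) = s(a, b)) with ⟨h1, h2⟩ | ⟨h1, h2⟩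
    · exact .inl ⟨h1 ▸ ha, h2 ▸ hb⟩
    · exact .inr ⟨h1 ▸ hb, h2 ▸ ha⟩
  · intro d' hd' hne
    rw [List.mem_toFinset] at hd'
    have hmem : d'.edge ∈ p.edges := List.mem_map_of_mem hd'
    rw [sideIndicator_add_eq_zero_iff]
    rintro (⟨h1, h2⟩ | ⟨h1, h2⟩)
    · exact hne (hinj d' hd' ((huniq _ _ hmem h1 h2).trans hde.symm))
    · have hsw : d'.edge = s(d'.snd, d'.fst) := Sym2.eq_swap
      exact hne (hinj d' hd' (hsw.trans ((huniq _ _ (hsw ▸ hmem) h2 h1).trans hde.symm)))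

lemma isCycleEdgeSet_iff {C : Set G.edgeSet} :
    G.IsCycleEdgeSet C ↔ ∃ (v : V) (p : G.Walk v v), p.IsCycle ∧
      C = {e : G.edgeSet | (e : Sym2 V) ∈ p.edges} := by
  have key : ∀ {v : V} (p : G.Walk v v), {e : Sym2 V | e ∈ p.edges} =
      Subtype.val '' {e : G.edgeSet | (e : Sym2 V) ∈ p.edges} := by
    intro v p
    ext e
    exact ⟨fun he => ⟨⟨e, p.edges_subset_edgeSet he⟩, he, rfl⟩, by rintro ⟨e, he, rfl⟩; exact he⟩
  unfold IsCycleEdgeSet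
  simp only [key, Subtype.val_injective.image_injective.eq_iff]

/-- In a dual graph, the forests are the complements of the spanning sets. -/
lemma IsDualGraph.isForestEdgeSet_iff [Finite V] {α : Type*} {H : Graph α G.edgeSet}
    (hG : G.Connected) (h : G.IsDualGraph H) (F : Set G.edgeSet) :
    H.IsForestEdgeSet F ↔ G.IsSpanningSet Fᶜ := by
  obtain ⟨hE, hdual⟩ := h
  constructor
  · rintro ⟨-, hF⟩
    have := hG.nonempty
    set K : SimpleGraph V := fromEdgeSet (Subtype.val '' Fᶜ) with hK
    by_cases hconn : K.Connected
    · obtain ⟨T, hTK, hT⟩ := hconn.exists_isTree_le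
      refine ⟨T, hT, (edgeSet_mono hTK).trans ?_⟩
      rw [hK, edgeSet_fromEdgeSet]
      exact Set.sdiff_subset
    exfalso
    obtain ⟨u, w, huw⟩ : ∃ u w, ¬ K.Reachable u w := by
      by_contra! hcon
      exact hconn ⟨hcon⟩
    set X : Set V := {v | K.Reachable u v} with hX
    have hcut : ∀ e : G.edgeSet, ∀ a b, (e : Sym2 V) = s(a, b) → a ∈ X → b ∉ X → e ∈ F := by
      intro e a b hab ha hb
      by_contra heF
      refine hb (ha.trans (Adj.reachable ?_))
      rw [hK, fromEdgeSet_adj]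
      exact ⟨⟨e, heF, hab⟩, by rintro rfl; exact hb ha⟩
    obtain ⟨q⟩ := hG.preconnected u w
    obtain ⟨d, -, hd1, hd2⟩ := q.exists_boundary_dart X (Reachable.refl u) huw
    -- `D` is a nonempty cut of `G` inside `F`. A cycle of `H` in `D` contradicts the forest
    -- property; otherwise a bond of `H` meets `D` in one edge, and this bond is a cycle of `G`
    -- crossing the cut `D` once.
    set D : Set G.edgeSet := {e | ∃ a ∈ X, ∃ b ∉ X, (e : Sym2 V) = s(a, b)} with hD
    have hDF : D ⊆ F := fun e ⟨a, ha, b, hb, hab⟩ => hcut e a b hab ha hb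
    rcases Graph.exists_isCycleEdgeSet_or_cut (H := H) (D := D) (e := ⟨d.edge, d.edge_mem⟩)
      ⟨_, hd1, _, hd2, rfl⟩ (by simp [hE]) with ⟨C, hCD, hC⟩ | ⟨Y, hY⟩
    · exact hF C (hCD.trans hDF) hC
    · have he : (⟨d.edge, d.edge_mem⟩ : G.edgeSet) ∈ D ∩ H.cut Y := hY ▸ rfl
      obtain ⟨B, hBY, heB, hB⟩ := Graph.exists_isBond_subset_cut he.2
      obtain ⟨v, p, hp, rfl⟩ := isCycleEdgeSet_iff.1 ((hdual B).2 hB)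
      refine hp.not_unique_crossing X (a := d.fst) (b := d.snd) heB hd1 hd2 ?_
      intro a b hab ha hb
      have hmem : (⟨s(a, b), p.edges_subset_edgeSet hab⟩ : G.edgeSet) ∈ D ∩ H.cut Y :=
        ⟨⟨a, ha, b, hb, rfl⟩, hBY hab⟩
      rw [hY] at hmem
      exact congrArg Subtype.val hmem
  · rintro ⟨T, hT, hTF⟩
    refine ⟨by simp [hE], fun C hCF hC => ?_⟩
    obtain ⟨e, heC⟩ : C.Nonempty := by
      obtain ⟨n, _, v, f, -, -, -, rfl⟩ := hC
      exact ⟨f 0, 0, rfl⟩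
    obtain ⟨⟨a, b⟩, hab⟩ := e
    obtain ⟨q, hq⟩ := (hT.connected.preconnected b a).exists_isPath
    have hTG : T ≤ G := by
      rw [← edgeSet_subset_edgeSet]
      exact hTF.trans (by rintro _ ⟨e, -, rfl⟩; exact e.2)
    have hqF : ∀ f : G.edgeSet, (f : Sym2 V) ∈ q.edges → f ∉ F := by
      intro f hf
      obtain ⟨f', hf', hff⟩ := hTF (q.edges_subset_edgeSet hf)
      rwa [Subtype.ext hff] at hf'
    have hadj : G.Adj a b := hab
    -- The fundamental cycle of an edge of `C` with respect to the tree is a bond of `H`. Its other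
    -- edges avoid `F`, so it meets the cycle `C` in one edge only, against parity.
    have hcyc : (Walk.cons hadj (q.mapLe hTG)).IsCycle := by
      rw [Walk.cons_isCycle_iff]
      refine ⟨(Walk.isPath_mapLe hTG).2 hq, fun hmem => ?_⟩
      rw [Walk.edges_mapLe_eq_edges] at hmem
      exact hqF ⟨s(a, b), hab⟩ hmem (hCF heC)
    have hB := ((hdual _).1 (isCycleEdgeSet_iff.2 ⟨a, _, hcyc, rfl⟩)).1
    obtain ⟨-, X, hX⟩ := hB
    refine hC.inter_cut_ne_singleton X ⟨s(a, b), hab⟩ ?_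
    rw [← hX]
    refine Set.eq_singleton_iff_unique_mem.2 ⟨⟨heC, by simp⟩, ?_⟩
    rintro f ⟨hfC, hf⟩
    simp only [Set.mem_ofPred_eq, Walk.edges_cons, List.mem_cons, Walk.edges_mapLe_eq_edges] at hf
    rcases hf with hf | hf
    · exact Subtype.ext hf
    · exact absurd (hCF hfC) (hqF f hf)

end SimpleGraph

end CyclesAndCuts

theorem mainTheorem4 {V : Type*} [Fintype V] [DecidableEq V] (G : SimpleGraph V)
    [DecidableRel G.Adj] (hG : G.Connected) :
    -- for every orientation, network matrices exist, and for each choice `[W | I]` of one: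
    (∀ o : G.EdgeOrientation,
      (∃ (T : Finset G.edgeSet) (W : Matrix {e // e ∈ T} {e // e ∉ T} ℝ),
        o.IsNetworkMatrix T W) ∧
      ∀ (T : Finset G.edgeSet) (W : Matrix {e // e ∈ T} {e // e ∉ T} ℝ),
        o.IsNetworkMatrix T W →
          -- the Ehrhart polynomial of the tocyclotope,
          IsEhrhartPolynomial (zonotope (SimpleGraph.dualBlockMatrix T W))
            (∑ k ∈ Finset.range (Fintype.card G.edgeSet + 1 - Fintype.card V + 1),
              Polynomial.C (G.numCospanning k : ℝ) * Polynomial.X ^ k) ∧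
          -- and its coefficients as numbers of independent sets of the cographic matroid,
          ∀ k : ℕ,
            {F : Finset G.edgeSet | F.card = k ∧
              LinearIndependent ℝ
                (fun e : F => (SimpleGraph.dualBlockMatrix T W).col (e : G.edgeSet))}.ncard =
              G.numCospanning k) ∧
    -- which are the forests in a dual graph, if there is one
    (∀ {α : Type*} (H : Graph α G.edgeSet), G.IsDualGraph H → ∀ k : ℕ,
      {F : Finset G.edgeSet | F.card = k ∧ H.IsForestEdgeSet (F : Set G.edgeSet)}.ncard =
        G.numCospanning k) := by
  refine ⟨fun o => ⟨o.exists_isNetworkMatrix hG, fun T W h =>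
    ⟨h.isEhrhartPolynomial hG, fun k => ?_⟩⟩, fun H hH k => ?_⟩
  · simp only [h.linearIndependent_iff hG, SimpleGraph.numCospanning]
  · simp only [hH.isForestEdgeSet_iff hG, SimpleGraph.numCospanning]
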